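/- For $n\ge 1$ let $\mathbb{M}_n$ be the algebra of $n\times n$ complex matrices, $\mathbb{M}_n^+$ the set of positive semidefinite matrices in it, ordered by $A\le B\iff B-A\in\mathbb{M}_n^+$, and $\|\cdot\|_\infty$ the operator norm. For a real function $g$ on $[0,\infty)$ and $A\in\mathbb{M}_n^+$, $g(A)$ is given by the functional calculus. A function $f:[0,\infty)\to\mathbb{R}$ is operator monotone if $0\le A\le B$ implies $f(A)\le f(B)$ for all matrices $A,B$ of every size. Let $\mathrm{OM}_{+,1}$ be the set of non-negative operator monotone functions $f$ on $[0,\infty)$ with $f(1)=1$, and for such $f$ let $f^*(x):=f(x^{-1})^{-1}$ for $x>0$, extended to $x=0$ by its limit from the right. **Proposition 2.1.** Let $\Phi:\mathbb{M}_n\to\mathbb{M}_l$ and $\Psi:\mathbb{M}_m\to\mathbb{M}_l$ be positive linear maps (that is, linear maps taking positive semidefinite matrices to positive semidefinite matrices). Let $f\in\mathrm{OM}_{+,1}$, and let $\varphi_0,\varphi_1$ be arbitrary non-negative functions on $[0,\infty)$. Then the limits $$\varphi(x)=(\varphi_0\,\sigma_f\,\varphi_1)(x):=\lim_{\varepsilon\searrow0}(\varphi_0(x)+\varepsilon)\,f\Bigl(\frac{\varphi_1(x)+\varepsilon}{\varphi_0(x)+\varepsilon}\Bigr),\qquad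 \widetilde\varphi(x)=(\varphi_0\,\sigma_f^*\,\varphi_1)(x):=\lim_{\varepsilon\searrow0}(\varphi_0(x)+\varepsilon)\,f^*\Bigl(\frac{\varphi_1(x)+\varepsilon}{\varphi_0(x)+\varepsilon}\Bigr)$$ exist for every $x\in[0,\infty)$, and for every $A\in\mathbb{M}_n^+$ and $B\in\mathbb{M}_m^+$, $$\bigl\|\Phi(\widetilde\varphi(A))^{1/2}\,\Psi(\varphi(B))\,\Phi(\widetilde\varphi(A))^{1/2}\bigr\|_\infty\le\max_{k=0,1}\bigl\|\Phi(\varphi_k(A))^{1/2}\,\Psi(\varphi_k(B))\,\Phi(\varphi_k(A))^{1/2}\bigr\|_\infty.$$ -/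

import Mathlib

open Filter Topology
open scoped MatrixOrder ComplexOrder Matrix.Norms.L2Operator

/-- `f` is operator monotone on `[0, ∞)`: `0 ≤ A ≤ B` implies `f(A) ≤ f(B)` for complex square
matrices of every size.  Here `≤` is the Loewner order and `f(A)` is the functional calculus of a
Hermitian matrix (defined for every function, since the spectrum is finite). -/
def OperatorMonotone (f : ℝ → ℝ) : Prop :=
  ∀ (n : ℕ) (A B : Matrix (Fin n) (Fin n) ℂ), A.PosSemidef → B.PosSemidef → A ≤ B →
    cfc f A ≤ cfc f B

/-- The set of non-negative operator monotone functions `f` on `[0, ∞)` with `f 1 = 1`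
(the values of `f` at negative numbers are irrelevant). -/
def OMPlusOne : Set (ℝ → ℝ) :=
  {f | (∀ x, 0 ≤ x → 0 ≤ f x) ∧ OperatorMonotone f ∧ f 1 = 1}

/-- The adjoint `f*` of `f`: `f*(x) = f(x⁻¹)⁻¹` for `x > 0`, extended to `0` by the limit
from the right (the values at negative numbers are irrelevant). -/
noncomputable def adjointFun (f : ℝ → ℝ) (x : ℝ) : ℝ :=
  if 0 < x then (f x⁻¹)⁻¹ else limUnder (𝓝[>] (0 : ℝ)) fun t => (f t⁻¹)⁻¹

/-- The regularized expression `(a + ε) f((b + ε) / (a + ε))`. -/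
noncomputable def meanApprox (f : ℝ → ℝ) (a b ε : ℝ) : ℝ :=
  (a + ε) * f ((b + ε) / (a + ε))

/-- The mean `φ₀ σ_f φ₁` of two functions:
`(φ₀ σ_f φ₁)(x) = lim_{ε ↘ 0} (φ₀ x + ε) f((φ₁ x + ε) / (φ₀ x + ε))`. -/
noncomputable def funMean (f φ₀ φ₁ : ℝ → ℝ) (x : ℝ) : ℝ :=
  limUnder (𝓝[>] (0 : ℝ)) (meanApprox f (φ₀ x) (φ₁ x))

/-!
The inequality is that of operator connections, `Φ(φ̃(A)) ≤ Φ(φ₀(A)) σ_{f*} Φ(φ₁(A))` and similarly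
for `Ψ`, combined with `X₀⁻¹ σ_f X₁⁻¹ = (X₀ σ_{f*} X₁)⁻¹`. Write `X₀, X₁` for `Φ(φ₀(A)), Φ(φ₁(A))` and
`Y₀, Y₁` for `Ψ(φ₀(B)), Ψ(φ₁(B))`. If the right-hand side is at most `γ`, then `Y₀ ≤ γ X₀⁻¹` and
`Y₁ ≤ γ X₁⁻¹`, so `Ψ(φ(B)) ≤ Y₀ σ_f Y₁ ≤ γ (X₀⁻¹ σ_f X₁⁻¹) = γ (X₀ σ_{f*} X₁)⁻¹ ≤ γ Φ(φ̃(A))⁻¹`.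

By the spectral theorem only the matrices `Φ(E)` and `Ψ(E)`, for `E` a spectral projection, matter,
and both estimates become instances of Jensen's operator inequality for a resolution of the identity,
`∑ g(tⱼ) Rⱼ ≤ g(∑ tⱼ Rⱼ)` (`Matrix.sum_smul_le_cfc_sum`). The monotonicity of `σ_f` in its first
argument is absorbed into it by a defect term `1 - ∑ Rⱼ` at the node `0`
(`OperatorMonotone.conj_mean_le`). Jensen's inequality follows from operator monotonicity by comparing
a matrix with one that is block diagonal for an isometry (`Matrix.conj_cfc_le_cfc_conj`). It is proved
up to a factor `1 + δ` in the argument of `g`; as `g(t) / t` is decreasing, that factor can be taken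
out and sent to `1`, and continuity of `g` is never needed. In particular an operator monotone `f` may
jump at `0`.

The inequality is first proved for positive scalar data and invertible `X₀, X₁`
(`norm_sqrt_mean_le`); the general case follows by regularization and continuity of the square root.
The limits defining `φ` and `φ̃` exist because the regularized means are monotone in `ε`
(`IsQuasiConcave.tendsto_meanApprox`).
-/

/-! ### Functional calculus and intertwining -/

variable {ι κ : Type*} [Fintype ι] [DecidableEq ι] [Fintype κ] [DecidableEq κ]

theorem Matrix.continuousOn_spectrum (A : Matrix ι ι ℂ) (g : ℝ → ℝ) :
    ContinuousOn g (spectrum ℝ A) :=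
  A.finite_real_spectrum.continuousOn g

theorem Matrix.aeval_mul_of_intertwines {X : Matrix κ κ ℂ} {Y : Matrix ι ι ℂ} {V : Matrix ι κ ℂ}
    (h : Y * V = V * X) (q : Polynomial ℝ) :
    Polynomial.aeval Y q * V = V * Polynomial.aeval X q := by
  induction q using Polynomial.induction_on' with
  | add p q hp hq => simp [Matrix.add_mul, Matrix.mul_add, hp, hq]
  | monomial k a =>
    have hk : Y ^ k * V = V * X ^ k := by
      induction k with
      | zero => simp
      | succ k ih => rw [pow_succ, pow_succ, Matrix.mul_assoc, h, ← Matrix.mul_assoc, ih,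
          Matrix.mul_assoc]
    simp [Polynomial.aeval_monomial, Algebra.algebraMap_eq_smul_one, hk]

/-- The functional calculus respects intertwining by a rectangular matrix: on the two finite spectra,
`g` agrees with a single interpolation polynomial. -/
theorem Matrix.cfc_mul_of_intertwines {X : Matrix κ κ ℂ} {Y : Matrix ι ι ℂ} {V : Matrix ι κ ℂ}
    (hX : X.IsHermitian) (hY : Y.IsHermitian) (h : Y * V = V * X) (g : ℝ → ℝ) :
    cfc g Y * V = V * cfc g X := by
  classical
  let s : Finset ℝ := X.finite_real_spectrum.toFinset ∪ Y.finite_real_spectrum.toFinset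
  let q : Polynomial ℝ := Lagrange.interpolate s id g
  have hq : ∀ x ∈ s, g x = q.eval x := fun x hx =>
    (Lagrange.eval_interpolate_at_node g (Set.injOn_id _) hx).symm
  have hqX : cfc g X = Polynomial.aeval X q := by
    rw [← cfc_polynomial q X hX]
    exact cfc_congr fun x hx => hq x (by simp [s, hx])
  have hqY : cfc g Y = Polynomial.aeval Y q := by
    rw [← cfc_polynomial q Y hY]
    exact cfc_congr fun x hx => hq x (by simp [s, hx])
  rw [hqX, hqY, Matrix.aeval_mul_of_intertwines h]

theorem Matrix.cfc_diagonal (t : ι → ℝ) (g : ℝ → ℝ) :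
    cfc g (Matrix.diagonal fun i => (t i : ℂ)) = Matrix.diagonal fun i => (g (t i) : ℂ) := by
  have hD : (Matrix.diagonal fun i => (t i : ℂ)).IsHermitian := by
    simp [Matrix.isHermitian_diagonal_iff, isSelfAdjoint_iff]
  ext i j
  -- the coordinate column `Pi.single j 1` intertwines the diagonal matrix with the scalar `t j`
  have h := Matrix.cfc_mul_of_intertwines (X := algebraMap ℝ (Matrix Unit Unit ℂ) (t j))
    (Y := Matrix.diagonal fun i => (t i : ℂ))
    (V := Matrix.of fun i _ => if i = j then 1 else 0) (IsSelfAdjoint.algebraMap _ (.all _)) hD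
    (by ext a b; by_cases hab : a = j <;> simp [Matrix.algebraMap_eq_diagonal, hab]) g
  rw [cfc_algebraMap] at h
  have := congr_fun (congr_fun h i) ()
  by_cases hij : i = j <;>
    simpa [Matrix.mul_apply, Matrix.algebraMap_eq_diagonal, Matrix.diagonal_apply, hij] using this

/-- Operator monotonicity, for matrices over an arbitrary finite index type. -/
theorem OperatorMonotone.cfc_le_cfc {f : ℝ → ℝ} (hf : OperatorMonotone f) {A B : Matrix ι ι ℂ}
    (hA : A.PosSemidef) (hB : B.PosSemidef) (hAB : A ≤ B) : cfc f A ≤ cfc f B := by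
  let e := Fintype.equivFin ι
  have key : ∀ C : Matrix ι ι ℂ, C.PosSemidef →
      cfc f (C.submatrix e.symm e.symm) = (cfc f C).submatrix e.symm e.symm := by
    intro C hC
    have h := Matrix.cfc_mul_of_intertwines (X := C) (Y := C.submatrix e.symm e.symm)
      (V := (1 : Matrix ι ι ℂ).submatrix e.symm id) hC.1 (hC.submatrix _).1
      (by
        ext a b
        simp [Matrix.mul_apply, Matrix.one_apply,
          e.symm.sum_comp fun i => if i = b then C (e.symm a) i else 0]) f
    ext a b
    have := congr_fun (congr_fun h a) (e.symm b)
    simpa [Matrix.mul_apply, Matrix.one_apply] using this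
  have h := hf _ _ _ (hA.submatrix e.symm) (hB.submatrix e.symm)
    ((Matrix.le_iff.mp hAB).submatrix e.symm)
  rw [key A hA, key B hB, Matrix.le_iff] at h
  have h' := h.submatrix e
  have hsub : ((cfc f B).submatrix e.symm e.symm - (cfc f A).submatrix e.symm e.symm).submatrix
      e e = cfc f B - cfc f A := by ext; simp
  rwa [hsub] at h'

/-! ### Jensen's operator inequality -/

/-- Jensen's inequality for compression by an isometry `V`, up to the slack `δ`. Only monotonicity
of `g` at `T` is used, so that the lemma applies both to functions that are operator monotone on
positive semidefinite matrices and to those that are so on positive definite ones. With `P = V V*`,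
the matrix `(1 + δ) P T P + (1 + δ⁻¹) (1 - P) T (1 - P)` dominates `T` and is intertwined by `V`
with `(1 + δ) V* T V`. Keeping `δ` avoids any continuity assumption on `g`. -/
theorem Matrix.conj_cfc_le_cfc_conj {V : Matrix ι κ ℂ} (hV : V.conjTranspose * V = 1)
    {T : Matrix ι ι ℂ} (hT : T.PosSemidef) {g : ℝ → ℝ}
    (hg : ∀ Y, T ≤ Y → cfc g T ≤ cfc g Y) {δ : ℝ} (hδ : 0 < δ) :
    V.conjTranspose * cfc g T * V ≤ cfc g ((1 + δ) • (V.conjTranspose * T * V)) := by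
  set P : Matrix ι ι ℂ := V * V.conjTranspose with hP
  have hPV : P * V = V := by rw [hP, Matrix.mul_assoc, hV, Matrix.mul_one]
  have hPh : P.conjTranspose = P := by simp [hP]
  set C : Matrix ι ι ℂ := √δ • P - (√δ)⁻¹ • (1 - P) with hC
  have hCh : C.conjTranspose = C := by simp [hC, hPh]
  have hCV : C * V = √δ • V := by simp [hC, Matrix.sub_mul, hPV]
  have hTY : T ≤ T + C * T * C := by
    have := hT.conjTranspose_mul_mul_same C
    rw [hCh] at this
    rw [Matrix.le_iff]; simpa using this
  have hYh : (T + C * T * C).IsHermitian := by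
    have := hT.conjTranspose_mul_mul_same C
    rw [hCh] at this
    exact (hT.add this).1
  have hX : ((1 + δ) • (V.conjTranspose * T * V)).IsHermitian := by
    have := (hT.conjTranspose_mul_mul_same V).1
    simp [Matrix.IsHermitian, this.eq]
  -- `T + C T C = (1 + δ) P T P + (1 + δ⁻¹) (1 - P) T (1 - P)`, so `V` intertwines
  have hYV : (T + C * T * C) * V = V * ((1 + δ) • (V.conjTranspose * T * V)) := by
    have h0 : √δ * √δ = δ := Real.mul_self_sqrt hδ.le
    have h1 : (√δ)⁻¹ * √δ = 1 := inv_mul_cancel₀ (Real.sqrt_pos.2 hδ).ne'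
    have e1 : (T + C * T * C) * V = T * V + √δ • (C * (T * V)) := by
      rw [Matrix.add_mul, Matrix.mul_assoc (C * T), hCV, Matrix.mul_smul, Matrix.mul_assoc]
    have e2 : √δ • (C * (T * V)) = δ • (P * (T * V)) - (T * V - P * (T * V)) := by
      rw [hC, Matrix.sub_mul, Matrix.smul_mul, Matrix.smul_mul, smul_sub, smul_smul, smul_smul, h0,
        mul_comm, h1, one_smul, Matrix.sub_mul, Matrix.one_mul]
    rw [e1, e2, Matrix.mul_smul, add_smul, one_smul, hP]
    simp only [Matrix.mul_assoc]
    abel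
  have h := Matrix.cfc_mul_of_intertwines hX hYh hYV g
  have h2 : (V.conjTranspose * (cfc g (T + C * T * C) - cfc g T) * V).PosSemidef :=
    (Matrix.le_iff.mp (hg _ hTY)).conjTranspose_mul_mul_same V
  rw [Matrix.le_iff]
  rw [Matrix.mul_sub, Matrix.sub_mul, Matrix.mul_assoc _ _ V, h, ← Matrix.mul_assoc, hV,
    Matrix.one_mul] at h2
  exact h2

/-- Jensen's inequality for a resolution of the identity `∑ R j = 1` by positive semidefinite
matrices: the square roots of the `R j`, stacked, form an isometry. -/
theorem Matrix.sum_smul_le_cfc_sum {J : Type*} [Fintype J] [DecidableEq J] {R : J → Matrix κ κ ℂ}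
    (hR : ∀ j, (R j).PosSemidef) (hsum : ∑ j, R j = 1) {t : J → ℝ} (ht : ∀ j, 0 ≤ t j)
    {g : ℝ → ℝ}
    (hg : ∀ Y : Matrix (J × κ) (J × κ) ℂ, (Matrix.diagonal fun p => (t p.1 : ℂ)) ≤ Y →
      cfc g (Matrix.diagonal fun p : J × κ => (t p.1 : ℂ)) ≤ cfc g Y) {δ : ℝ} (hδ : 0 < δ) :
    ∑ j, g (t j) • R j ≤ cfc g ((1 + δ) • ∑ j, t j • R j) := by
  let V : Matrix (J × κ) κ ℂ := Matrix.of fun p b => CFC.sqrt (R p.1) p.2 b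
  have hV : ∀ s : J → ℝ, V.conjTranspose *
      (Matrix.diagonal fun p => (s p.1 : ℂ) : Matrix (J × κ) (J × κ) ℂ) * V =
      ∑ j, s j • R j := by
    intro s
    have hr : ∀ j, R j = (CFC.sqrt (R j)).conjTranspose * CFC.sqrt (R j) := fun j => by
      rw [(Matrix.nonneg_iff_posSemidef.1 (CFC.sqrt_nonneg (R j))).1.eq,
        CFC.sqrt_mul_sqrt_self (R j) (Matrix.nonneg_iff_posSemidef.2 (hR j))]
    ext a b
    simp only [Matrix.sum_apply, Matrix.smul_apply]
    conv_rhs => enter [2, j]; rw [hr j]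
    simp only [Matrix.mul_assoc, Matrix.mul_apply (M := V.conjTranspose),
      Matrix.diagonal_mul, Fintype.sum_prod_type, V,
      Matrix.conjTranspose_apply, Matrix.of_apply, Complex.real_smul]
    refine Finset.sum_congr rfl fun j _ => ?_
    rw [Matrix.mul_apply (M := (CFC.sqrt (R j)).conjTranspose), Finset.mul_sum]
    refine Finset.sum_congr rfl fun c _ => ?_
    rw [Matrix.conjTranspose_apply]
    ring
  have h1 : V.conjTranspose * V = 1 := by
    have := hV fun _ => 1
    simpa [hsum] using this
  have hT : (Matrix.diagonal fun p : J × κ => (t p.1 : ℂ)).PosSemidef := by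
    refine Matrix.PosSemidef.diagonal fun p => ?_
    simpa using ht p.1
  have := Matrix.conj_cfc_le_cfc_conj h1 hT hg hδ
  rwa [Matrix.cfc_diagonal (fun p : J × κ => t p.1) g, hV t, hV fun j => g (t j)] at this

omit [Fintype κ] [DecidableEq κ] in
theorem Matrix.PosSemidef.of_le {A B : Matrix κ κ ℂ} (hA : A.PosSemidef) (h : A ≤ B) :
    B.PosSemidef :=
  Matrix.nonneg_iff_posSemidef.1 ((Matrix.nonneg_iff_posSemidef.2 hA).trans h)

omit [Fintype κ] [DecidableEq κ] in
theorem Matrix.PosDef.of_le {A B : Matrix κ κ ℂ} (hA : A.PosDef) (h : A ≤ B) : B.PosDef := by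
  simpa using hA.add_posSemidef (Matrix.le_iff.1 h)

theorem OperatorMonotone.sum_smul_le_cfc {J : Type*} [Fintype J] [DecidableEq J] {f : ℝ → ℝ}
    (hf : OperatorMonotone f) {R : J → Matrix κ κ ℂ} (hR : ∀ j, (R j).PosSemidef)
    (hsum : ∑ j, R j = 1) {t : J → ℝ} (ht : ∀ j, 0 ≤ t j) {δ : ℝ} (hδ : 0 < δ) :
    ∑ j, f (t j) • R j ≤ cfc f ((1 + δ) • ∑ j, t j • R j) := by
  refine Matrix.sum_smul_le_cfc_sum hR hsum ht (fun Y hY => ?_) hδ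
  have hT : (Matrix.diagonal fun p : J × κ => (t p.1 : ℂ)).PosSemidef :=
    Matrix.PosSemidef.diagonal fun p => by simpa using ht p.1
  exact hf.cfc_le_cfc hT (hT.of_le hY) hY

/-! ### Quasi-concavity of operator monotone functions -/

/-- Quasi-concave functions on `(0, ∞)` in the sense of interpolation theory: `g` is positive and
increasing, and `g x / x` is decreasing (stated without division). -/
structure IsQuasiConcave (g : ℝ → ℝ) : Prop where
  pos : ∀ x, 0 < x → 0 < g x
  mono : ∀ x y, 0 < x → x ≤ y → g x ≤ g y
  mul_le_mul : ∀ x y, 0 < x → x ≤ y → x * g y ≤ y * g x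

omit [Fintype κ] in
theorem Matrix.smul_one_le_smul_one [Nonempty κ] {a b : ℝ}
    (h : a • (1 : Matrix κ κ ℂ) ≤ b • 1) : a ≤ b := by
  obtain ⟨i⟩ := ‹Nonempty κ›
  have := (Matrix.le_iff.1 h).diag_nonneg (i := i)
  simp only [Matrix.sub_apply, Matrix.smul_apply, Matrix.one_apply_eq, Complex.real_smul, mul_one,
    sub_nonneg] at this
  exact_mod_cast this

/-- Scalar Jensen inequality for the weights `c` at `t` and `1 - c` at `0`, where `f 0 ≥ 0` is
discarded. -/
theorem OperatorMonotone.mul_apply_le_apply_mul {f : ℝ → ℝ} (hf : OperatorMonotone f) (h0 : 0 ≤ f 0) {c t δ : ℝ}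
    (hc : 0 ≤ c) (hc1 : c ≤ 1) (ht : 0 ≤ t) (hδ : 0 < δ) : c * f t ≤ f ((1 + δ) * (c * t)) := by
  have hps : ∀ r : ℝ, 0 ≤ r → (r • (1 : Matrix Unit Unit ℂ)).PosSemidef := fun r hr =>
    Matrix.PosSemidef.one.smul hr
  have h := hf.sum_smul_le_cfc (R := ![c • (1 : Matrix Unit Unit ℂ), (1 - c) • 1])
    (by simpa [Fin.forall_fin_two] using ⟨hps c hc, hps _ (sub_nonneg.2 hc1)⟩)
    (by simp [← add_smul]) (t := ![t, 0]) (by simpa [Fin.forall_fin_two] using ht) hδ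
  have h1 : (1 + δ) • (t • c • (1 : Matrix Unit Unit ℂ)) =
      algebraMap ℝ _ ((1 + δ) * (c * t)) := by
    rw [Algebra.algebraMap_eq_smul_one, smul_smul, smul_smul]; ring_nf
  simp only [Fin.sum_univ_two, Matrix.cons_val_zero, Matrix.cons_val_one, zero_smul,
    add_zero] at h
  rw [h1, cfc_algebraMap, Algebra.algebraMap_eq_smul_one, smul_smul, smul_smul, ← add_smul] at h
  have := Matrix.smul_one_le_smul_one h
  nlinarith [mul_nonneg h0 (sub_nonneg.2 hc1)]

theorem OperatorMonotone.le_of_le {f : ℝ → ℝ} (hf : OperatorMonotone f) {x y : ℝ}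
    (hx : 0 ≤ x) (hxy : x ≤ y) : f x ≤ f y := by
  have hps : ∀ r : ℝ, 0 ≤ r → (algebraMap ℝ (Matrix Unit Unit ℂ) r).PosSemidef := fun r hr => by
    rw [Algebra.algebraMap_eq_smul_one]; exact Matrix.PosSemidef.one.smul hr
  have h := hf.cfc_le_cfc (hps x hx) (hps y (hx.trans hxy)) (by
    rw [Matrix.le_iff, ← map_sub]; exact hps _ (sub_nonneg.2 hxy))
  rw [cfc_algebraMap, cfc_algebraMap, Algebra.algebraMap_eq_smul_one,
    Algebra.algebraMap_eq_smul_one] at h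
  exact Matrix.smul_one_le_smul_one h

theorem isQuasiConcave_of_mem_OMPlusOne {f : ℝ → ℝ} (hf : f ∈ OMPlusOne) : IsQuasiConcave f := by
  obtain ⟨h0, hm, h1⟩ := hf
  have hq : ∀ x y, 0 < x → x ≤ y → x * f y ≤ y * f x := by
    intro x y hx hxy
    have hy := hx.trans_le hxy
    -- the constant `c = x / ((1 + δ) y)` turns the Jensen inequality into the claim up to `1 + δ`
    have key : ∀ δ : ℝ, 0 < δ → x * f y ≤ (1 + δ) * (y * f x) := by
      intro δ hδ
      have h := hm.mul_apply_le_apply_mul (h0 0 le_rfl) (c := x / ((1 + δ) * y)) (t := y) (by positivity)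
        (by rw [div_le_one (by positivity)]; nlinarith) hy.le hδ
      have e : (1 + δ) * (x / ((1 + δ) * y) * y) = x := by field_simp
      rw [e, div_mul_eq_mul_div, div_le_iff₀ (by positivity)] at h
      linarith
    have hlim : Tendsto (fun δ : ℝ => (1 + δ) * (y * f x)) (𝓝[>] 0) (𝓝 ((1 + 0) * (y * f x))) :=
      ((by fun_prop : Continuous fun δ : ℝ => (1 + δ) * (y * f x)).tendsto 0).mono_left
        nhdsWithin_le_nhds
    have := ge_of_tendsto hlim (eventually_mem_nhdsWithin.mono fun δ hδ => key δ hδ)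
    linarith
  refine ⟨fun x hx => ?_, fun x y hx hxy => hm.le_of_le hx.le hxy, hq⟩
  rcases le_total 1 x with h | h
  · linarith [hm.le_of_le zero_le_one h]
  · have := hq x 1 hx h
    rw [h1] at this
    linarith

theorem adjointFun_of_pos (f : ℝ → ℝ) {x : ℝ} (hx : 0 < x) : adjointFun f x = (f x⁻¹)⁻¹ :=
  if_pos hx

theorem IsQuasiConcave.adjointFun {f : ℝ → ℝ} (hf : IsQuasiConcave f) :
    IsQuasiConcave (adjointFun f) := by
  refine ⟨fun x hx => ?_, fun x y hx hxy => ?_, fun x y hx hxy => ?_⟩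
  · rw [adjointFun_of_pos f hx]
    exact inv_pos.2 (hf.pos _ (inv_pos.2 hx))
  · have hy := hx.trans_le hxy
    rw [adjointFun_of_pos f hx, adjointFun_of_pos f hy]
    exact inv_anti₀ (hf.pos _ (inv_pos.2 hy)) (hf.mono _ _ (inv_pos.2 hy) (inv_anti₀ hx hxy))
  · have hy := hx.trans_le hxy
    rw [adjointFun_of_pos f hx, adjointFun_of_pos f hy]
    have h := hf.mul_le_mul _ _ (inv_pos.2 hy) (inv_anti₀ hx hxy)
    have hfx := hf.pos _ (inv_pos.2 hx)
    have hfy := hf.pos _ (inv_pos.2 hy)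
    rw [← div_eq_mul_inv, ← div_eq_mul_inv, div_le_div_iff₀ hfy hfx]
    rw [inv_mul_eq_div, inv_mul_eq_div, div_le_div_iff₀ hy hx] at h
    linarith

/-- Quasi-concavity makes `a * g (b / a)` increasing in both `a` and `b`, so the regularized
expression decreases as `ε ↘ 0`. -/
theorem IsQuasiConcave.tendsto_meanApprox {g : ℝ → ℝ} (hg : IsQuasiConcave g) {a b : ℝ}
    (ha : 0 ≤ a) (hb : 0 ≤ b) :
    Tendsto (meanApprox g a b) (𝓝[>] 0) (𝓝 (limUnder (𝓝[>] 0) (meanApprox g a b))) := by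
  have hmono : MonotoneOn (meanApprox g a b) (Set.Ioi 0) := by
    intro ε hε η hη h
    have hε : 0 < ε := hε
    have hη : 0 < η := hη
    have h1 : 0 < a + ε := by linarith
    have h2 : 0 < a + η := by linarith
    have h3 : 0 < b + ε := by linarith
    have h4 : 0 < b + η := by linarith
    have h5 : meanApprox g a b ε ≤ (a + η) * g ((b + ε) / (a + η)) := by
      have := hg.mul_le_mul ((b + ε) / (a + η)) ((b + ε) / (a + ε)) (by positivity) (by gcongr)
      rw [div_mul_eq_mul_div, div_mul_eq_mul_div, div_le_div_iff₀ h2 h1] at this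
      have h6 : (b + ε) * ((a + ε) * g ((b + ε) / (a + ε))) ≤
        (b + ε) * ((a + η) * g ((b + ε) / (a + η))) := by linarith
      exact le_of_mul_le_mul_left h6 h3
    refine h5.trans ?_
    unfold meanApprox
    exact mul_le_mul_of_nonneg_left (hg.mono _ _ (by positivity) (by gcongr)) h2.le
  refine tendsto_nhds_limUnder ⟨_, hmono.tendsto_nhdsGT ⟨0, ?_⟩⟩
  rintro _ ⟨ε, hε, rfl⟩
  have hε : 0 < ε := hε
  exact mul_nonneg (by linarith) (hg.pos _ (by positivity)).le

/-! ### Functional calculus of positive definite matrices -/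

theorem Matrix.PosDef.pos_of_mem_spectrum {A : Matrix κ κ ℂ} (hA : A.PosDef) {x : ℝ}
    (hx : x ∈ spectrum ℝ A) : 0 < x := by
  obtain ⟨i, rfl⟩ := hA.1.spectrum_real_eq_range_eigenvalues ▸ hx
  exact hA.eigenvalues_pos i

theorem Matrix.PosDef.cfc {A : Matrix κ κ ℂ} (hA : A.PosDef) {g : ℝ → ℝ}
    (hg : ∀ x, 0 < x → 0 < g x) : (cfc g A).PosDef := by
  exact Matrix.isStrictlyPositive_iff_posDef.1 <|
    (cfc_isStrictlyPositive_iff g A (A.continuousOn_spectrum g) hA.1).2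
      fun x hx => hg x (hA.pos_of_mem_spectrum hx)

theorem IsQuasiConcave.cfc_smul_le {g : ℝ → ℝ} (hg : IsQuasiConcave g) {S : Matrix κ κ ℂ}
    (hS : S.PosDef) {c : ℝ} (hc : 1 ≤ c) : cfc g (c • S) ≤ c • cfc g S := by
  have hS' : IsSelfAdjoint S := hS.1
  rw [← cfc_comp_smul c g S ((S.finite_real_spectrum.image _).continuousOn _) hS',
    ← cfc_smul c g S (S.continuousOn_spectrum g)]
  refine cfc_mono (fun x hx => ?_) (S.continuousOn_spectrum _) (S.continuousOn_spectrum _)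
  have hx := hS.pos_of_mem_spectrum hx
  have := hg.mul_le_mul x (c * x) hx (by nlinarith)
  simp only [smul_eq_mul]
  have h6 : x * g (c * x) ≤ x * (c * g x) := by linarith
  exact le_of_mul_le_mul_left h6 hx

theorem Matrix.PosDef.inv_le_inv {A B : Matrix κ κ ℂ} (hA : A.PosDef) (h : A ≤ B) :
    B⁻¹ ≤ A⁻¹ := by
  rw [Matrix.nonsing_inv_eq_ringInverse, Matrix.nonsing_inv_eq_ringInverse]
  exact CStarAlgebra.ringInverse_le_ringInverse h (Matrix.isStrictlyPositive_iff_posDef.2 hA)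

theorem Matrix.PosDef.inv_eq_cfc {A : Matrix κ κ ℂ} (hA : A.PosDef) :
    A⁻¹ = _root_.cfc (fun x : ℝ => x⁻¹) A := by
  have hA' : IsSelfAdjoint A := hA.1
  refine Matrix.inv_eq_right_inv ?_
  conv_lhs => enter [1]; rw [← cfc_id' ℝ A]
  rw [← cfc_mul _ _ A (A.continuousOn_spectrum _) (A.continuousOn_spectrum _), ← cfc_one ℝ A]
  exact cfc_congr fun x hx => mul_inv_cancel₀ (hA.pos_of_mem_spectrum hx).ne'

theorem cfc_adjointFun {f : ℝ → ℝ} (hf : ∀ x, 0 < x → 0 < f x) {A : Matrix κ κ ℂ}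
    (hA : A.PosDef) : cfc (adjointFun f) A = (cfc f A⁻¹)⁻¹ := by
  have hA' : IsSelfAdjoint A := hA.1
  symm
  refine Matrix.inv_eq_right_inv ?_
  rw [hA.inv_eq_cfc, ← cfc_comp' f _ A ((A.finite_real_spectrum.image _).continuousOn _)
      (A.continuousOn_spectrum _),
    ← cfc_mul _ _ A (A.continuousOn_spectrum _) (A.continuousOn_spectrum _), ← cfc_one ℝ A]
  refine cfc_congr fun x hx => ?_
  have hx := hA.pos_of_mem_spectrum hx
  rw [adjointFun_of_pos f hx]
  exact mul_inv_cancel₀ (hf _ (inv_pos.2 hx)).ne'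

/-- The adjoint of an operator monotone function is operator monotone on positive definite
matrices. -/
theorem OperatorMonotone.cfc_adjointFun_le {f : ℝ → ℝ} (hf : OperatorMonotone f)
    (hpos : ∀ x, 0 < x → 0 < f x) {A B : Matrix κ κ ℂ} (hA : A.PosDef) (h : A ≤ B) :
    cfc (adjointFun f) A ≤ cfc (adjointFun f) B := by
  have hB := hA.of_le h
  rw [cfc_adjointFun hpos hA, cfc_adjointFun hpos hB]
  exact (hB.inv.cfc hpos).inv_le_inv
    (hf.cfc_le_cfc hB.inv.posSemidef hA.inv.posSemidef (hA.inv_le_inv h))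

/-! ### Congruences, square roots and norms -/

omit [DecidableEq κ] in
theorem Matrix.IsHermitian.conj_le_conj {H A B : Matrix κ κ ℂ} (hH : H.IsHermitian) (h : A ≤ B) :
    H * A * H ≤ H * B * H := by
  have := (Matrix.le_iff.1 h).conjTranspose_mul_mul_same H
  rw [hH.eq, Matrix.mul_sub, Matrix.sub_mul] at this
  exact Matrix.le_iff.2 this

omit [DecidableEq κ] in
theorem Matrix.PosSemidef.conj_of_isHermitian {H A : Matrix κ κ ℂ} (hA : A.PosSemidef)
    (hH : H.IsHermitian) : (H * A * H).PosSemidef := by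
  simpa [hH.eq] using hA.conjTranspose_mul_mul_same H

theorem Matrix.isHermitian_sqrt (A : Matrix κ κ ℂ) : (CFC.sqrt A).IsHermitian :=
  (Matrix.nonneg_iff_posSemidef.1 (CFC.sqrt_nonneg A)).1

theorem Matrix.PosSemidef.sqrt_mul_sqrt {A : Matrix κ κ ℂ} (hA : A.PosSemidef) :
    CFC.sqrt A * CFC.sqrt A = A :=
  CFC.sqrt_mul_sqrt_self A (Matrix.nonneg_iff_posSemidef.2 hA)

theorem Matrix.PosDef.exists_inv_sqrt {A : Matrix κ κ ℂ} (hA : A.PosDef) :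
    ∃ K : Matrix κ κ ℂ, K.IsHermitian ∧ CFC.sqrt A * K = 1 ∧ K * CFC.sqrt A = 1 ∧
      A⁻¹ = K * K := by
  have hu : IsUnit (CFC.sqrt A) :=
    (CFC.isUnit_sqrt_iff A (Matrix.nonneg_iff_posSemidef.2 hA.posSemidef)).2 hA.isUnit
  have hd := (Matrix.isUnit_iff_isUnit_det _).1 hu
  refine ⟨(CFC.sqrt A)⁻¹, (Matrix.isHermitian_sqrt A).inv, Matrix.mul_nonsing_inv _ hd,
    Matrix.nonsing_inv_mul _ hd, ?_⟩
  rw [← Matrix.mul_inv_rev, hA.posSemidef.sqrt_mul_sqrt]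

theorem Matrix.PosSemidef.norm_le_iff {A : Matrix κ κ ℂ} (hA : A.PosSemidef) {r : ℝ}
    (hr : 0 ≤ r) : ‖A‖ ≤ r ↔ A ≤ r • 1 := by
  rw [CStarAlgebra.norm_le_iff_le_algebraMap A hr (Matrix.nonneg_iff_posSemidef.2 hA),
    Algebra.algebraMap_eq_smul_one]

omit [Fintype κ] [DecidableEq κ] in
theorem Matrix.smul_le_smul_left {A B : Matrix κ κ ℂ} (h : A ≤ B) {r : ℝ} (hr : 0 ≤ r) :
    r • A ≤ r • B := by
  rw [Matrix.le_iff, ← smul_sub]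
  exact (Matrix.le_iff.1 h).smul hr

/-- If `X ≤ a W` and `Y ≤ b W⁻¹`, then `√X Y √X ≤ b √X W⁻¹ √X`, whose norm is that of
`b W^(-1/2) X W^(-1/2) ≤ a b` by the C⋆-identity. -/
theorem Matrix.norm_sqrt_mul_mul_sqrt_le {X Y W : Matrix κ κ ℂ} (hX : X.PosSemidef)
    (hY : Y.PosSemidef) (hW : W.PosDef) {a b : ℝ} (ha : 0 ≤ a) (hb : 0 ≤ b)
    (hXW : X ≤ a • W) (hYW : Y ≤ b • W⁻¹) : ‖CFC.sqrt X * Y * CFC.sqrt X‖ ≤ a * b := by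
  obtain ⟨K, hK, hHK, hKH, hWi⟩ := hW.exists_inv_sqrt
  have h1 : CFC.sqrt X * Y * CFC.sqrt X ≤ b • (CFC.sqrt X * (K * K) * CFC.sqrt X) := by
    have := (Matrix.isHermitian_sqrt X).conj_le_conj hYW
    rwa [hWi, Matrix.mul_smul, Matrix.smul_mul] at this
  have h2 : ‖CFC.sqrt X * (K * K) * CFC.sqrt X‖ = ‖K * X * K‖ := by
    have e1 : CFC.sqrt X * (K * K) * CFC.sqrt X = star (K * CFC.sqrt X) * (K * CFC.sqrt X) := by
      rw [star_mul, Matrix.star_eq_conjTranspose, Matrix.star_eq_conjTranspose, hK.eq,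
        (Matrix.isHermitian_sqrt X).eq]
      simp only [Matrix.mul_assoc]
    have e2 : K * X * K = (K * CFC.sqrt X) * star (K * CFC.sqrt X) := by
      rw [star_mul, Matrix.star_eq_conjTranspose, Matrix.star_eq_conjTranspose, hK.eq,
        (Matrix.isHermitian_sqrt X).eq]
      conv_lhs => rw [← hX.sqrt_mul_sqrt]
      simp only [Matrix.mul_assoc]
    rw [e1, e2, CStarRing.norm_star_mul_self, CStarRing.norm_self_mul_star]
  have h3 : ‖K * X * K‖ ≤ a := by
    rw [(hX.conj_of_isHermitian hK).norm_le_iff ha]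
    refine (hK.conj_le_conj hXW).trans_eq ?_
    rw [Matrix.mul_smul, Matrix.smul_mul, ← hW.posSemidef.sqrt_mul_sqrt]
    simp only [← Matrix.mul_assoc]
    rw [hKH, Matrix.one_mul, hHK]
  calc _ ≤ ‖b • (CFC.sqrt X * (K * K) * CFC.sqrt X)‖ :=
        CStarAlgebra.norm_le_norm_of_nonneg_of_le (Matrix.nonneg_iff_posSemidef.2
          (hY.conj_of_isHermitian (Matrix.isHermitian_sqrt X))) h1
    _ = b * ‖K * X * K‖ := by rw [norm_smul, h2, Real.norm_of_nonneg hb]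
    _ ≤ b * a := by gcongr
    _ = a * b := mul_comm _ _

/-! ### Inequalities for operator means -/

omit [DecidableEq κ] in
theorem Matrix.conj_sum_smul {J : Type*} [Fintype J] (H : Matrix κ κ ℂ) (Q : J → Matrix κ κ ℂ)
    (w : J → ℝ) : H * (∑ j, w j • Q j) * H = ∑ j, w j • (H * Q j * H) := by
  simp only [Finset.mul_sum, Finset.sum_mul, Matrix.mul_smul, Matrix.smul_mul]

/-- An upper bound for a weighted sum of scalar means in terms of `Y₀ = ∑ b₀ Q` and `Y₁ = ∑ b₁ Q`.
The hypothesis says that the matrices `γ⁻¹ b₀ H Q H` sum to at most `1`; the defect is added to them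
as a further term at the node `0`, where `f 0 ≥ 0`. -/
theorem OperatorMonotone.conj_mean_le {J : Type*} [Fintype J] [DecidableEq J] {f : ℝ → ℝ}
    (hf : OperatorMonotone f) (hf0 : 0 ≤ f 0) {Q : J → Matrix κ κ ℂ} (hQ : ∀ j, (Q j).PosSemidef)
    {b₀ b₁ : J → ℝ} (hb₀ : ∀ j, 0 < b₀ j) (hb₁ : ∀ j, 0 ≤ b₁ j) {H : Matrix κ κ ℂ}
    (hH : H.IsHermitian) {γ : ℝ} (hγ : 0 < γ) (h0 : H * (∑ j, b₀ j • Q j) * H ≤ γ • 1)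
    {δ : ℝ} (hδ : 0 < δ) :
    H * (∑ j, (b₀ j * f (b₁ j / b₀ j)) • Q j) * H ≤
      γ • cfc f ((1 + δ) • γ⁻¹ • (H * (∑ j, b₁ j • Q j) * H)) := by
  let R : Option J → Matrix κ κ ℂ := fun o =>
    o.elim (1 - γ⁻¹ • (H * (∑ j, b₀ j • Q j) * H)) fun j => (γ⁻¹ * b₀ j) • (H * Q j * H)
  let t : Option J → ℝ := fun o => o.elim 0 fun j => b₁ j / b₀ j
  have hN : (1 - γ⁻¹ • (H * (∑ j, b₀ j • Q j) * H)).PosSemidef := by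
    have := Matrix.smul_le_smul_left h0 (inv_nonneg.2 hγ.le)
    rwa [smul_smul, inv_mul_cancel₀ hγ.ne', one_smul] at this
  have hR : ∀ o, (R o).PosSemidef := by
    rintro (_ | j)
    · exact hN
    · exact ((hQ j).conj_of_isHermitian hH).smul (mul_nonneg (inv_nonneg.2 hγ.le) (hb₀ j).le)
  have hsum : ∑ o, R o = 1 := by
    simp [R, Fintype.sum_option, Matrix.conj_sum_smul, Finset.smul_sum, mul_smul]
  have ht : ∀ o, 0 ≤ t o := by
    rintro (_ | j)
    · exact le_rfl
    · exact div_nonneg (hb₁ j) (hb₀ j).le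
  have h := hf.sum_smul_le_cfc hR hsum ht hδ
  have e1 : ∑ o, t o • R o = γ⁻¹ • (H * (∑ j, b₁ j • Q j) * H) := by
    simp only [R, t, Fintype.sum_option, Option.elim, zero_smul, zero_add, Matrix.conj_sum_smul,
      Finset.smul_sum, smul_smul]
    refine Finset.sum_congr rfl fun j _ => ?_
    congr 1
    have := (hb₀ j).ne'
    field_simp
  have e2 : γ⁻¹ • (H * (∑ j, (b₀ j * f (b₁ j / b₀ j)) • Q j) * H) ≤ ∑ o, f (t o) • R o := by
    have e3 : ∑ o, f (t o) • R o = γ⁻¹ • (H * (∑ j, (b₀ j * f (b₁ j / b₀ j)) • Q j) * H) +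
        f 0 • (1 - γ⁻¹ • (H * (∑ j, b₀ j • Q j) * H)) := by
      rw [Matrix.conj_sum_smul H Q fun j => b₀ j * f (b₁ j / b₀ j), add_comm]
      simp only [R, t, Fintype.sum_option, Option.elim, Finset.smul_sum, smul_smul]
      congr 1
      refine Finset.sum_congr rfl fun j _ => ?_
      congr 1
      ring
    rw [e3]
    exact le_add_of_nonneg_right (Matrix.nonneg_iff_posSemidef.2 (hN.smul hf0))
  rw [e1] at h
  have := Matrix.smul_le_smul_left (e2.trans h) hγ.le
  rwa [smul_smul, mul_inv_cancel₀ hγ.ne', one_smul] at this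

/-- The same bound for the adjoint function, under the exact normalization `K X₀ K = 1`. There is no
defect term here, so all nodes are positive and the value of `adjointFun f` at `0` plays no role. -/
theorem OperatorMonotone.mean_adjointFun_le {J : Type*} [Fintype J] [DecidableEq J] {f : ℝ → ℝ}
    (hf : OperatorMonotone f) (hpos : ∀ x, 0 < x → 0 < f x) {P : J → Matrix κ κ ℂ}
    (hP : ∀ j, (P j).PosSemidef)
    {a₀ a₁ : J → ℝ} (ha₀ : ∀ j, 0 < a₀ j) (ha₁ : ∀ j, 0 < a₁ j) {K : Matrix κ κ ℂ}
    (hK : K.IsHermitian) (h0 : K * (∑ j, a₀ j • P j) * K = 1) {δ : ℝ} (hδ : 0 < δ) :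
    K * (∑ j, (a₀ j * adjointFun f (a₁ j / a₀ j)) • P j) * K ≤
      cfc (adjointFun f) ((1 + δ) • (K * (∑ j, a₁ j • P j) * K)) := by
  have ht : ∀ j, 0 < a₁ j / a₀ j := fun j => div_pos (ha₁ j) (ha₀ j)
  have h := Matrix.sum_smul_le_cfc_sum (R := fun j => a₀ j • (K * P j * K)) (g := adjointFun f)
    (t := fun j => a₁ j / a₀ j)
    (fun j => ((hP j).conj_of_isHermitian hK).smul (ha₀ j).le)
    (by rwa [← Matrix.conj_sum_smul]) (fun j => (ht j).le)
    (fun Y hY => hf.cfc_adjointFun_le hpos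
      (Matrix.PosDef.diagonal fun p => by exact_mod_cast ht p.1) hY) hδ
  convert h using 2
  · rw [Matrix.conj_sum_smul]
    refine Finset.sum_congr rfl fun j _ => ?_
    rw [smul_smul, mul_comm]
  · rw [Matrix.conj_sum_smul]
    congr 1
    refine Finset.sum_congr rfl fun j _ => ?_
    rw [smul_smul, div_mul_cancel₀ _ (ha₀ j).ne']

/-- The norm inequality for positive scalar data and invertible `X₀`, `X₁`. With
`S = X₀^(-1/2) X₁ X₀^(-1/2)` and `W = X₀^(1/2) f*(S) X₀^(1/2)`, the first matrix is at most `(1 + δ) W`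
and the second at most `(1 + δ) γ W⁻¹`. -/
theorem norm_sqrt_mean_le {f : ℝ → ℝ} (hf : f ∈ OMPlusOne) {I J : Type*} [Fintype I]
    [DecidableEq I] [Fintype J] [DecidableEq J] {P : I → Matrix κ κ ℂ} {Q : J → Matrix κ κ ℂ}
    (hP : ∀ i, (P i).PosSemidef) (hQ : ∀ j, (Q j).PosSemidef) {a₀ a₁ : I → ℝ} {b₀ b₁ : J → ℝ}
    (ha₀ : ∀ i, 0 < a₀ i) (ha₁ : ∀ i, 0 < a₁ i) (hb₀ : ∀ j, 0 < b₀ j) (hb₁ : ∀ j, 0 < b₁ j)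
    (hX₀ : (∑ i, a₀ i • P i).PosDef) (hX₁ : (∑ i, a₁ i • P i).PosDef) {γ : ℝ} (hγ : 0 < γ)
    (h₀ : ‖CFC.sqrt (∑ i, a₀ i • P i) * (∑ j, b₀ j • Q j) * CFC.sqrt (∑ i, a₀ i • P i)‖ ≤ γ)
    (h₁ : ‖CFC.sqrt (∑ i, a₁ i • P i) * (∑ j, b₁ j • Q j) * CFC.sqrt (∑ i, a₁ i • P i)‖ ≤ γ) :
    ‖CFC.sqrt (∑ i, (a₀ i * adjointFun f (a₁ i / a₀ i)) • P i) *
        (∑ j, (b₀ j * f (b₁ j / b₀ j)) • Q j) *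
        CFC.sqrt (∑ i, (a₀ i * adjointFun f (a₁ i / a₀ i)) • P i)‖ ≤ γ := by
  have hq := isQuasiConcave_of_mem_OMPlusOne hf
  have hsumQ : ∀ w : J → ℝ, (∀ j, 0 ≤ w j) → (∑ j, w j • Q j).PosSemidef := fun w hw =>
    Matrix.posSemidef_sum _ fun j _ => (hQ j).smul (hw j)
  have hsumP : ∀ w : I → ℝ, (∀ j, 0 ≤ w j) → (∑ j, w j • P j).PosSemidef := fun w hw =>
    Matrix.posSemidef_sum _ fun j _ => (hP j).smul (hw j)
  have hYm := hsumQ (fun j => b₀ j * f (b₁ j / b₀ j)) fun j =>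
    mul_nonneg (hb₀ j).le (hq.pos _ (div_pos (hb₁ j) (hb₀ j))).le
  have hXm := hsumP (fun j => a₀ j * adjointFun f (a₁ j / a₀ j)) fun j =>
    mul_nonneg (ha₀ j).le (hq.adjointFun.pos _ (div_pos (ha₁ j) (ha₀ j))).le
  have hY₀ := hsumQ b₀ fun j => (hb₀ j).le
  have hY₁ := hsumQ b₁ fun j => (hb₁ j).le
  have hM := fun (δ : ℝ) (hδ : 0 < δ) (K : Matrix κ κ ℂ) (hK : K.IsHermitian) h0 =>
    hf.2.1.mean_adjointFun_le hq.pos hP ha₀ ha₁ hK h0 hδ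
  have hN := fun (δ : ℝ) (hδ : 0 < δ) => hf.2.1.conj_mean_le (hf.1 0 le_rfl) hQ hb₀
    (fun j => (hb₁ j).le) (Matrix.isHermitian_sqrt (∑ i, a₀ i • P i)) hγ
    (((hY₀.conj_of_isHermitian (Matrix.isHermitian_sqrt _)).norm_le_iff hγ.le).1 h₀) hδ
  set X₀ := ∑ i, a₀ i • P i
  set X₁ := ∑ i, a₁ i • P i
  set Y₀ := ∑ j, b₀ j • Q j
  set Y₁ := ∑ j, b₁ j • Q j
  set X := ∑ i, (a₀ i * adjointFun f (a₁ i / a₀ i)) • P i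
  set Y := ∑ j, (b₀ j * f (b₁ j / b₀ j)) • Q j
  obtain ⟨K, hK, hHK, hKH, -⟩ := hX₀.exists_inv_sqrt
  have hH := Matrix.isHermitian_sqrt X₀
  have hHH := hX₀.posSemidef.sqrt_mul_sqrt
  set H := CFC.sqrt X₀
  have cHK : ∀ M, H * (K * M * K) * H = M := fun M => by
    rw [show H * (K * M * K) * H = (H * K) * M * (K * H) by simp only [Matrix.mul_assoc], hHK, hKH,
      Matrix.one_mul, Matrix.mul_one]
  have cKH : ∀ M, K * (H * M * H) * K = M := fun M => by
    rw [show K * (H * M * H) * K = (K * H) * M * (H * K) by simp only [Matrix.mul_assoc], hHK, hKH,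
      Matrix.one_mul, Matrix.mul_one]
  have hH' : IsUnit H := ⟨⟨H, K, hHK, hKH⟩, rfl⟩
  have hK' : IsUnit K := ⟨⟨K, H, hKH, hHK⟩, rfl⟩
  have conj_pd : ∀ {C M : Matrix κ κ ℂ}, C.IsHermitian → IsUnit C → M.PosDef →
      (C * M * C).PosDef := fun {C M} hC hu hM => by
    have := (Matrix.IsUnit.posDef_star_left_conjugate_iff hu (x := M)).2 hM
    rwa [Matrix.star_eq_conjTranspose, hC.eq] at this
  have hS : (K * X₁ * K).PosDef := conj_pd hK hK' hX₁
  have hSi : (K * X₁ * K)⁻¹ = H * X₁⁻¹ * H := by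
    refine Matrix.inv_eq_right_inv ?_
    have hd := (Matrix.isUnit_iff_isUnit_det _).1 hX₁.isUnit
    rw [show K * X₁ * K * (H * X₁⁻¹ * H) = K * X₁ * (K * H) * X₁⁻¹ * H by
      simp only [Matrix.mul_assoc], hKH, Matrix.mul_one, Matrix.mul_assoc K,
      Matrix.mul_nonsing_inv _ hd, Matrix.mul_one, hKH]
  set S := K * X₁ * K
  have hW : (H * cfc (adjointFun f) S * H).PosDef :=
    conj_pd hH hH' (hS.cfc hq.adjointFun.pos)
  have hWi : (H * cfc (adjointFun f) S * H)⁻¹ = K * cfc f S⁻¹ * K := by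
    have hF := hS.inv.cfc hq.pos
    have hd := (Matrix.isUnit_iff_isUnit_det _).1 hF.isUnit
    refine Matrix.inv_eq_right_inv ?_
    rw [cfc_adjointFun hq.pos hS, show ∀ F : Matrix κ κ ℂ,
      H * F⁻¹ * H * (K * F * K) = H * F⁻¹ * (H * K) * F * K by
      intro F; simp only [Matrix.mul_assoc], hHK, Matrix.mul_one, Matrix.mul_assoc H,
      Matrix.nonsing_inv_mul _ hd, Matrix.mul_one, hHK]
  -- `Y₁ ≤ γ X₁⁻¹`, conjugated by `H = X₀^(1/2)`
  have hY₁X : H * Y₁ * H ≤ γ • S⁻¹ := by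
    obtain ⟨L, hL, hGL, hLG, hLL⟩ := hX₁.exists_inv_sqrt
    have h2 := (hY₁.conj_of_isHermitian (Matrix.isHermitian_sqrt X₁)).norm_le_iff hγ.le |>.1 h₁
    have h3 := hL.conj_le_conj h2
    rw [show ∀ G, L * (G * Y₁ * G) * L = (L * G) * Y₁ * (G * L) by
      intro G; simp only [Matrix.mul_assoc], hLG, hGL, Matrix.one_mul, Matrix.mul_one,
      Matrix.mul_smul, Matrix.mul_one, Matrix.smul_mul, ← hLL] at h3
    have h4 := hH.conj_le_conj h3
    rwa [Matrix.mul_smul, Matrix.smul_mul, ← hSi] at h4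
  have key : ∀ δ : ℝ, 0 < δ → ‖CFC.sqrt X * Y * CFC.sqrt X‖ ≤ (1 + δ) * ((1 + δ) * γ) := by
    intro δ hδ
    have h1δ : (1 : ℝ) ≤ 1 + δ := by linarith
    have hXW : X ≤ (1 + δ) • (H * cfc (adjointFun f) S * H) := by
      have h := (hM δ hδ K hK (by rw [← hHH]; simpa using cKH 1)).trans
        (hq.adjointFun.cfc_smul_le hS h1δ)
      have := hH.conj_le_conj h
      rwa [cHK, Matrix.mul_smul, Matrix.smul_mul] at this
    have hYW : Y ≤ ((1 + δ) * γ) • (H * cfc (adjointFun f) S * H)⁻¹ := by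
      have h2 : (1 + δ) • γ⁻¹ • (H * Y₁ * H) ≤ (1 + δ) • S⁻¹ := by
        refine Matrix.smul_le_smul_left ?_ (by linarith)
        have := Matrix.smul_le_smul_left hY₁X (inv_nonneg.2 hγ.le)
        rwa [smul_smul, inv_mul_cancel₀ hγ.ne', one_smul] at this
      have hps : ((1 + δ) • γ⁻¹ • (H * Y₁ * H)).PosSemidef :=
        ((hY₁.conj_of_isHermitian hH).smul (inv_nonneg.2 hγ.le)).smul (by linarith)
      have h3 := (hf.2.1.cfc_le_cfc hps (hps.of_le h2) h2).trans (hq.cfc_smul_le hS.inv h1δ)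
      have h4 := hK.conj_le_conj ((hN δ hδ).trans (Matrix.smul_le_smul_left h3 hγ.le))
      rwa [cKH, smul_smul, Matrix.mul_smul, Matrix.smul_mul, ← hWi, mul_comm] at h4
    exact Matrix.norm_sqrt_mul_mul_sqrt_le hXm hYm hW (by linarith) (by positivity) hXW hYW
  have hlim : Tendsto (fun δ : ℝ => (1 + δ) * ((1 + δ) * γ)) (𝓝[>] 0)
      (𝓝 ((1 + 0) * ((1 + 0) * γ))) :=
    ((by fun_prop : Continuous fun δ : ℝ => (1 + δ) * ((1 + δ) * γ)).tendsto 0).mono_left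
      nhdsWithin_le_nhds
  simpa using ge_of_tendsto hlim (eventually_mem_nhdsWithin.mono fun δ hδ => key δ hδ)

/-! ### Positive maps and the passage to the limit -/

/-- Spectral decomposition: the nodes and the projections do not depend on `g`. -/
theorem Matrix.PosSemidef.exists_cfc_eq_sum {A : Matrix κ κ ℂ} (hA : A.PosSemidef) :
    ∃ (lam : κ → ℝ) (E : κ → Matrix κ κ ℂ), (∀ i, 0 ≤ lam i) ∧ (∀ i, (E i).PosSemidef) ∧
      ∀ g : ℝ → ℝ, _root_.cfc g A = ∑ i, g (lam i) • E i := by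
  let U : Matrix κ κ ℂ := hA.1.eigenvectorUnitary
  refine ⟨hA.1.eigenvalues, fun i => U * Matrix.diagonal (Pi.single i 1) * U.conjTranspose,
    hA.eigenvalues_nonneg, fun i => ?_, fun g => ?_⟩
  · refine Matrix.PosSemidef.mul_mul_conjTranspose_same (Matrix.PosSemidef.diagonal ?_) U
    exact Pi.single_nonneg.2 zero_le_one
  · have hd : Matrix.diagonal (RCLike.ofReal ∘ g ∘ hA.1.eigenvalues) =
        ∑ i, g (hA.1.eigenvalues i) • Matrix.diagonal (Pi.single i (1 : ℂ)) := by
      ext a b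
      by_cases hab : a = b
      · simp [hab, Matrix.sum_apply, Pi.single_apply]
      · simp [hab, Matrix.sum_apply]
    rw [hA.1.cfc_eq g, Matrix.IsHermitian.cfc, Unitary.conjStarAlgAut_apply, hd]
    simp only [Finset.mul_sum, Finset.sum_mul, Matrix.mul_smul, Matrix.smul_mul]
    rfl

omit [Fintype κ] [DecidableEq κ] in
theorem PositiveLinearMap.exists_apply_cfc_eq_sum
    (Φ : Matrix ι ι ℂ →ₚ[ℂ] Matrix κ κ ℂ) {A : Matrix ι ι ℂ} (hA : A.PosSemidef) :
    ∃ (lam : ι → ℝ) (P : ι → Matrix κ κ ℂ), (∀ i, 0 ≤ lam i) ∧ (∀ i, (P i).PosSemidef) ∧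
      ∀ g : ℝ → ℝ, Φ (cfc g A) = ∑ i, g (lam i) • P i := by
  obtain ⟨lam, E, hl, hE, h⟩ := hA.exists_cfc_eq_sum
  refine ⟨lam, fun i => Φ (E i), hl, fun i => ?_, fun g => ?_⟩
  · exact Matrix.nonneg_iff_posSemidef.1 (map_nonneg Φ (Matrix.nonneg_iff_posSemidef.2 (hE i)))
  · rw [h g, map_sum]
    refine Finset.sum_congr rfl fun i _ => ?_
    rw [← Complex.coe_smul, ← Complex.coe_smul, map_smul]

theorem Matrix.tendsto_norm_sqrt_mul_mul_sqrt {α : Type*} {l : Filter α} {X Y : α → Matrix κ κ ℂ}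
    {X' Y' : Matrix κ κ ℂ} (hX : Tendsto X l (𝓝 X')) (hY : Tendsto Y l (𝓝 Y'))
    (hX0 : ∀ᶠ a in l, (X a).PosSemidef) (hX' : X'.PosSemidef) :
    Tendsto (fun a => ‖CFC.sqrt (X a) * Y a * CFC.sqrt (X a)‖) l
      (𝓝 ‖CFC.sqrt X' * Y' * CFC.sqrt X'‖) := by
  have hs : Tendsto (fun a => CFC.sqrt (X a)) l (𝓝 (CFC.sqrt X')) :=
    (CFC.continuousOn_sqrt X' (Matrix.nonneg_iff_posSemidef.2 hX')).tendsto.comp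
      (tendsto_nhdsWithin_iff.2 ⟨hX, hX0.mono fun a ha => Matrix.nonneg_iff_posSemidef.2 ha⟩)
  exact ((hs.mul hY).mul hs).norm

theorem adjointFun_one {f : ℝ → ℝ} (h1 : f 1 = 1) : adjointFun f 1 = 1 := by
  rw [adjointFun_of_pos f one_pos, inv_one, h1, inv_one]

theorem proposition2p1 {n m l : ℕ}
    (Φ : Matrix (Fin n) (Fin n) ℂ →ₚ[ℂ] Matrix (Fin l) (Fin l) ℂ)
    (Ψ : Matrix (Fin m) (Fin m) ℂ →ₚ[ℂ] Matrix (Fin l) (Fin l) ℂ)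
    (f : ℝ → ℝ) (hf : f ∈ OMPlusOne)
    (φ₀ φ₁ : ℝ → ℝ) (hφ₀ : ∀ x, 0 ≤ x → 0 ≤ φ₀ x) (hφ₁ : ∀ x, 0 ≤ x → 0 ≤ φ₁ x)
    (A : Matrix (Fin n) (Fin n) ℂ) (hA : A.PosSemidef)
    (B : Matrix (Fin m) (Fin m) ℂ) (hB : B.PosSemidef) :
    (∀ x, 0 ≤ x →
      Tendsto (meanApprox f (φ₀ x) (φ₁ x)) (𝓝[>] 0) (𝓝 (funMean f φ₀ φ₁ x))) ∧
    (∀ x, 0 ≤ x →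
      Tendsto (meanApprox (adjointFun f) (φ₀ x) (φ₁ x)) (𝓝[>] 0)
        (𝓝 (funMean (adjointFun f) φ₀ φ₁ x))) ∧
    ‖CFC.sqrt (Φ (cfc (funMean (adjointFun f) φ₀ φ₁) A)) * Ψ (cfc (funMean f φ₀ φ₁) B) *
        CFC.sqrt (Φ (cfc (funMean (adjointFun f) φ₀ φ₁) A))‖ ≤
      max
        ‖CFC.sqrt (Φ (cfc φ₀ A)) * Ψ (cfc φ₀ B) * CFC.sqrt (Φ (cfc φ₀ A))‖
        ‖CFC.sqrt (Φ (cfc φ₁ A)) * Ψ (cfc φ₁ B) * CFC.sqrt (Φ (cfc φ₁ A))‖ := by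
  have hq := isQuasiConcave_of_mem_OMPlusOne hf
  have hlim : ∀ x, 0 ≤ x →
      Tendsto (meanApprox f (φ₀ x) (φ₁ x)) (𝓝[>] 0) (𝓝 (funMean f φ₀ φ₁ x)) := fun x hx =>
    hq.tendsto_meanApprox (hφ₀ x hx) (hφ₁ x hx)
  have hlim' : ∀ x, 0 ≤ x → Tendsto (meanApprox (adjointFun f) (φ₀ x) (φ₁ x)) (𝓝[>] 0)
      (𝓝 (funMean (adjointFun f) φ₀ φ₁ x)) := fun x hx =>
    hq.adjointFun.tendsto_meanApprox (hφ₀ x hx) (hφ₁ x hx)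
  refine ⟨hlim, hlim', ?_⟩
  obtain ⟨lam, P, hlam, hP, hΦ⟩ := Φ.exists_apply_cfc_eq_sum hA
  obtain ⟨mu, Q, hmu, hQ, hΨ⟩ := Ψ.exists_apply_cfc_eq_sum hB
  rw [hΦ, hΨ, hΦ, hΨ, hΦ, hΨ]
  -- the summand `ε • 1` at the extra index `none`, with both weights equal to `1`, makes the sums
  -- positive definite; it survives unchanged in the mean because `adjointFun f 1 = 1`
  have hP' : ∀ ε : ℝ, 0 < ε → ∀ o : Option (Fin n), (o.elim (ε • 1) P).PosSemidef := by
    rintro ε hε (_ | i)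
    · exact Matrix.PosSemidef.one.smul hε.le
    · exact hP i
  have hsum : ∀ (ε : ℝ) (w : Option (Fin n) → ℝ), w none = 1 →
      ∑ o, w o • (o.elim (ε • 1) P : Matrix (Fin l) (Fin l) ℂ) =
        ε • 1 + ∑ i, w (some i) • P i := by
    intro ε w hw
    simp [Fintype.sum_option, hw]
  have hpd : ∀ (ε : ℝ) (w : Fin n → ℝ), 0 < ε → (∀ i, 0 ≤ w i) →
      (ε • 1 + ∑ i, w i • P i).PosDef := fun ε w hε hw =>
    (Matrix.PosDef.one.smul hε).add_posSemidef
      (Matrix.posSemidef_sum _ fun i _ => (hP i).smul (hw i))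
  have hε0 : Tendsto (fun ε : ℝ => ε) (𝓝[>] 0) (𝓝 0) := nhdsWithin_le_nhds
  have hplus : ∀ c : ℝ, Tendsto (fun ε : ℝ => c + ε) (𝓝[>] 0) (𝓝 c) := fun c => by
    simpa using tendsto_const_nhds.add hε0
  have tendsX : ∀ (w : ℝ → Fin n → ℝ) (v : Fin n → ℝ),
      (∀ i, Tendsto (fun ε => w ε i) (𝓝[>] 0) (𝓝 (v i))) →
      Tendsto (fun ε : ℝ => ε • (1 : Matrix (Fin l) (Fin l) ℂ) + ∑ i, w ε i • P i) (𝓝[>] 0)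
        (𝓝 (∑ i, v i • P i)) := fun w v h => by
    simpa using (hε0.smul_const (1 : Matrix (Fin l) (Fin l) ℂ)).add
      (tendsto_finsetSum Finset.univ fun i _ => (h i).smul_const (P i))
  have tendsY : ∀ (w : ℝ → Fin m → ℝ) (v : Fin m → ℝ),
      (∀ i, Tendsto (fun ε => w ε i) (𝓝[>] 0) (𝓝 (v i))) →
      Tendsto (fun ε : ℝ => ∑ i, w ε i • Q i) (𝓝[>] 0) (𝓝 (∑ i, v i • Q i)) := fun w v h =>
    tendsto_finsetSum Finset.univ fun i _ => (h i).smul_const (Q i)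
  have tends : ∀ (w : ℝ → Fin n → ℝ) (v : Fin n → ℝ) (w' : ℝ → Fin m → ℝ) (v' : Fin m → ℝ),
      (∀ i, Tendsto (fun ε => w ε i) (𝓝[>] 0) (𝓝 (v i))) → (∀ ε, 0 < ε → ∀ i, 0 ≤ w ε i) →
      (∀ i, Tendsto (fun ε => w' ε i) (𝓝[>] 0) (𝓝 (v' i))) →
      Tendsto (fun ε : ℝ => ‖CFC.sqrt (ε • 1 + ∑ i, w ε i • P i) * (∑ i, w' ε i • Q i) *
        CFC.sqrt (ε • 1 + ∑ i, w ε i • P i)‖) (𝓝[>] 0)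
        (𝓝 ‖CFC.sqrt (∑ i, v i • P i) * (∑ i, v' i • Q i) * CFC.sqrt (∑ i, v i • P i)‖) := by
    intro w v w' v' hw hw0 hw'
    refine Matrix.tendsto_norm_sqrt_mul_mul_sqrt (tendsX w v hw) (tendsY w' v' hw')
      (eventually_mem_nhdsWithin.mono fun ε hε => (hpd ε _ hε (hw0 ε hε)).posSemidef) ?_
    refine Matrix.posSemidef_sum _ fun i _ => (hP i).smul ?_
    exact ge_of_tendsto (hw i) (eventually_mem_nhdsWithin.mono fun ε hε => hw0 ε hε i)
  have hpos : ∀ {φ : ℝ → ℝ}, (∀ x, 0 ≤ x → 0 ≤ φ x) → ∀ {x ε : ℝ}, 0 ≤ x → 0 < ε →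
      0 < φ x + ε := fun h _ _ hx hε => add_pos_of_nonneg_of_pos (h _ hx) hε
  have t0 := tends (fun ε i => φ₀ (lam i) + ε) _ (fun ε i => φ₀ (mu i) + ε) _
    (fun i => hplus _) (fun ε hε i => (hpos hφ₀ (hlam i) hε).le) (fun i => hplus _)
  have t1 := tends (fun ε i => φ₁ (lam i) + ε) _ (fun ε i => φ₁ (mu i) + ε) _
    (fun i => hplus _) (fun ε hε i => (hpos hφ₁ (hlam i) hε).le) (fun i => hplus _)
  have hm0 : ∀ ε, 0 < ε → ∀ i, 0 ≤ meanApprox (adjointFun f) (φ₀ (lam i)) (φ₁ (lam i)) ε :=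
    fun ε hε i => mul_nonneg (hpos hφ₀ (hlam i) hε).le
      (hq.adjointFun.pos _ (div_pos (hpos hφ₁ (hlam i) hε) (hpos hφ₀ (hlam i) hε))).le
  have tm := tends (fun ε i => meanApprox (adjointFun f) (φ₀ (lam i)) (φ₁ (lam i)) ε) _
    (fun ε i => meanApprox f (φ₀ (mu i)) (φ₁ (mu i)) ε) _
    (fun i => hlim' _ (hlam i)) hm0 (fun i => hlim _ (hmu i))
  -- the bound for regularized data is applied with `max … + ε`, which is positive
  have tmax := (t0.max t1).add hε0
  rw [add_zero] at tmax
  refine le_of_tendsto_of_tendsto tm tmax (eventually_mem_nhdsWithin.mono fun ε hε => ?_)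
  have hε : 0 < ε := hε
  have hw : ∀ {φ : ℝ → ℝ}, (∀ x, 0 ≤ x → 0 ≤ φ x) → ∀ o : Option (Fin n),
      0 < o.elim 1 fun i => φ (lam i) + ε := by
    rintro φ h (_ | i)
    · exact one_pos
    · exact hpos h (hlam i) hε
  have e0 := hsum ε (fun o => o.elim 1 fun i => φ₀ (lam i) + ε) rfl
  have e1 := hsum ε (fun o => o.elim 1 fun i => φ₁ (lam i) + ε) rfl
  have em := hsum ε (fun o => (o.elim 1 fun i => φ₀ (lam i) + ε) * adjointFun f
    ((o.elim 1 fun i => φ₁ (lam i) + ε) / (o.elim 1 fun i => φ₀ (lam i) + ε)))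
    (by simp [adjointFun_one hf.2.2])
  have h := fun (γ : ℝ) (hγ : 0 < γ) => norm_sqrt_mean_le hf (hP' ε hε) hQ (hw hφ₀) (hw hφ₁)
    (b₀ := fun j => φ₀ (mu j) + ε) (b₁ := fun j => φ₁ (mu j) + ε)
    (fun j => hpos hφ₀ (hmu j) hε) (fun j => hpos hφ₁ (hmu j) hε)
    (by rw [e0]; exact hpd ε _ hε fun i => (hpos hφ₀ (hlam i) hε).le)
    (by rw [e1]; exact hpd ε _ hε fun i => (hpos hφ₁ (hlam i) hε).le) hγ
  rw [e0, e1, em] at h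
  exact h _ (add_pos_of_nonneg_of_pos (le_max_of_le_left (norm_nonneg _)) hε)
    ((le_max_left _ _).trans (le_add_of_nonneg_right hε.le))
    ((le_max_right _ _).trans (le_add_of_nonneg_right hε.le))
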